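/- **Theorem 2.** A *square Ising Hamiltonian of size $N$* is a function $$H(b)=\sum_{\{u,v\}} c_{uv}\,b_u b_v+\sum_v M_v\,b_v,\qquad b\in\{0,1\}^V,\quad V=\{1,\dots,N\}^2,\quad c_{uv},M_v\in\mathbb R,$$ where the first sum runs over unordered pairs of distinct sites and $c_{uv}\neq 0$ exactly when $u$ and $v$ are nearest neighbours in the $N\times N$ square grid. Its ground states are its minimizers. Given $f:\{0,1\}^n\to\{0,1\}^m$, the ground states of $H$ *encode* $f$ if there are $n$ input sites and $m$ output sites, all pairwise distinct, such that for every $x\in\{0,1\}^n$ there is exactly one ground state whose input spins are $x$, and in every ground state with input spins $x$ the output spins are $f(x)$ (the remaining spins are ancillae). (i) For all $n,m\ge 0$ and every Boolean function $f:\{0,1\}^n\to\{0,1\}^m$ there is a square Ising Hamiltonian whose ground states encode $f$. (ii) There is a polynomial $P$ such that for all $n,m\ge 0$, every $f:\{0,1\}^n\to\{0,1\}^m$ and every Boolean circuit $C$ that computes $f$ (built from constants and arbitrary two-input gates, with unrestricted fan-out), there is a square Ising Hamiltonian whose ground states encode $f$ and whose number of spins $N^2$ is at most $P(|C|)$, where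 $|C|$ is the number of inputs, outputs and gates of $C$. -/

import Mathlib

/-- A Boolean gate reading from `w` available wires: a constant, or an arbitrary binary
operation applied to two (possibly equal) wires. -/
inductive BoolGate (w : ℕ) : Type
  | const (b : Bool) : BoolGate w
  | binary (op : Bool → Bool → Bool) (i j : Fin w) : BoolGate w

/-- The output bit of a gate, given the values on the wires. -/
def BoolGate.eval {w : ℕ} : BoolGate w → (Fin w → Bool) → Bool
  | .const b, _ => b
  | .binary op i j, v => op (v i) (v j)

/-- A straight-line sequence of gates starting from `n` input wires and ending with `w` wires;
every gate reads from the wires already present (with unrestricted fan-out) and adds one wire. -/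
inductive GateSeq (n : ℕ) : ℕ → Type
  | nil : GateSeq n n
  | snoc {w : ℕ} (c : GateSeq n w) (g : BoolGate w) : GateSeq n (w + 1)

/-- The number of gates. -/
def GateSeq.length {n : ℕ} : {w : ℕ} → GateSeq n w → ℕ
  | _, .nil => 0
  | _, .snoc c _ => c.length + 1

/-- The values of all wires on the input `x`. -/
def GateSeq.eval {n : ℕ} (x : Fin n → Bool) : {w : ℕ} → GateSeq n w → Fin w → Bool
  | _, .nil => x
  | _, .snoc c g => Fin.snoc (α := fun _ => Bool) (c.eval x) (g.eval (c.eval x))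

/-- A Boolean circuit with `n` input bits and `m` output bits: a sequence of gates, and a choice
of the wires that carry the outputs. -/
structure BoolCircuit (n m : ℕ) where
  wires : ℕ
  body : GateSeq n wires
  out : Fin m → Fin wires

/-- The Boolean function computed by a circuit. -/
def BoolCircuit.eval {n m : ℕ} (C : BoolCircuit n m) (x : Fin n → Bool) : Fin m → Bool :=
  fun j => C.body.eval x (C.out j)

/-- The size of a circuit: the number of its inputs, outputs and gates. -/
def BoolCircuit.size {n m : ℕ} (C : BoolCircuit n m) : ℕ :=
  n + m + C.body.length

/-- The value `0` or `1` of a spin as a real number. -/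
def spinValue (b : Bool) : ℝ := if b then 1 else 0

/-- The data of an Ising Hamiltonian (with external field) on the spins `V`:
`coupling u v` is the interaction energy of the unordered pair of distinct spins `u`, `v`. -/
structure IsingHamiltonian (V : Type) where
  coupling : V → V → ℝ
  coupling_symm : ∀ u v, coupling u v = coupling v u
  coupling_self : ∀ v, coupling v v = 0
  field : V → ℝ

namespace IsingHamiltonian

variable {V : Type}

/-- The energy of a state: the sum of `c_uv b_u b_v` over unordered pairs of distinct spins
(each pair occurs twice in the double sum, hence the division by 2),
plus the sum of `M_v b_v` over the spins. -/
noncomputable def energy [Fintype V] (H : IsingHamiltonian V) (b : V → Bool) : ℝ :=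
  (∑ u, ∑ v, H.coupling u v * spinValue (b u) * spinValue (b v)) / 2
    + ∑ v, H.field v * spinValue (b v)

/-- The ground states are the states of least energy. -/
def IsGroundState [Fintype V] (H : IsingHamiltonian V) (b : V → Bool) : Prop :=
  ∀ b' : V → Bool, H.energy b ≤ H.energy b'

/-- Two spins are joined by an edge if their interaction energy is nonzero. -/
def interactionGraph (H : IsingHamiltonian V) : SimpleGraph V where
  Adj u v := H.coupling u v ≠ 0
  symm := ⟨fun u v h => by rwa [H.coupling_symm v u]⟩
  loopless := ⟨fun v h => h (H.coupling_self v)⟩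

/-- The ground states of `H` encode `f`, with designated, pairwise distinct input spins
`site (inl i)` and output spins `site (inr j)`; all other spins are ancillae. The set of ground
states is `{x s_x f(x)}`: exactly one ground state for each input `x`, and every ground state has
outputs equal to `f` of its inputs. -/
def Encodes [Fintype V] {n m : ℕ} (H : IsingHamiltonian V) (site : Fin n ⊕ Fin m ↪ V)
    (f : (Fin n → Bool) → (Fin m → Bool)) : Prop :=
  (∀ x : Fin n → Bool, ∃! b : V → Bool,
      H.IsGroundState b ∧ ∀ i, b (site (Sum.inl i)) = x i) ∧
    ∀ b : V → Bool, H.IsGroundState b →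
      ∀ j, b (site (Sum.inr j)) = f (fun i => b (site (Sum.inl i))) j

end IsingHamiltonian

/-- The `N × N` square grid (with free boundary). -/
def squareGrid (N : ℕ) : SimpleGraph (Fin N × Fin N) :=
  SimpleGraph.boxProd (SimpleGraph.pathGraph N) (SimpleGraph.pathGraph N)

/-- A square Ising Hamiltonian of size `N`: the spins are the sites of the `N × N` grid, and
the interaction graph is the grid. -/
def IsingHamiltonian.IsSquare {N : ℕ} (H : IsingHamiltonian (Fin N × Fin N)) : Prop :=
  H.interactionGraph = squareGrid N

/-! The grid is read as a space-time diagram: a row is the state of a line of bits, and passing to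
the next row applies a layer of gates. On the plaquettes at `(t, j)` with `t + j` even, a
checkerboard, sits a gate on the columns `j`, `j + 1`. Every edge off the boundary lies on exactly
one such plaquette, so up to a constant the energy is a sum of plaquette penalties plus boundary
terms. Each penalty is nonnegative and vanishes exactly when the bottom spins are the gate's output
(`Brick.penalty_eq_zero_iff`). A field on the first row forces all non-input spins to zero. Hence
the ground states are exactly the histories of the network, one per input
(`brickwork_isGroundState_iff`).

The grid demands a nonzero interaction on every edge, including the boundary edges on no plaquette.
In the first and last rows these are couplings of strength 1, harmless if one endpoint is zero. Data
therefore lives in even columns, with zeros in the odd columns at the start and the end; the zeros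
also serve as working space.

The bricks (wire, and NOR written to either side) suffice to swap neighbouring cells and to apply
any binary operation to them (`implements_swap`, `implements_combine_succ`). Swaps bring distant
cells together, so a circuit compiles into quadratically many steps. Part (i) follows from part
(ii)'s construction because every Boolean function has a circuit. -/

/-! ### Grid Hamiltonians with prescribed bonds and fields -/

/-- The interaction along the edge from `u` to its right or lower neighbour `v`, when the
horizontal and vertical interactions of the grid are given by `h` and `w`. -/
noncomputable def gridBond (h w : ℕ → ℕ → ℝ) {N : ℕ} (u v : Fin N × Fin N) : ℝ :=
  (if (u.1 : ℕ) = v.1 ∧ (u.2 : ℕ) + 1 = v.2 then h u.1 u.2 else 0) +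
    (if (u.1 : ℕ) + 1 = v.1 ∧ (u.2 : ℕ) = v.2 then w u.1 u.2 else 0)

/-- The Hamiltonian on the grid with horizontal interactions `h`, vertical interactions `w` and
external field `M`, all indexed by row and column. -/
noncomputable def gridHamiltonian (N : ℕ) (h w M : ℕ → ℕ → ℝ) :
    IsingHamiltonian (Fin N × Fin N) where
  coupling u v := gridBond h w u v + gridBond h w v u
  coupling_symm u v := add_comm _ _
  coupling_self v := by simp [gridBond]
  field v := M v.1 v.2

/-- For adjacent sites exactly one of the four indicator conditions holds, so bonds cannot cancel;
otherwise none holds. -/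
theorem gridHamiltonian_isSquare {N : ℕ} {h w : ℕ → ℕ → ℝ} (M : ℕ → ℕ → ℝ)
    (hh : ∀ t j, j + 1 < N → h t j ≠ 0) (hw : ∀ t j, w t j ≠ 0) :
    (gridHamiltonian N h w M).IsSquare := by
  ext ⟨a, b⟩ ⟨c, d⟩
  have h1 : (gridHamiltonian N h w M).interactionGraph.Adj (a, b) (c, d) ↔
      gridBond h w (a, b) (c, d) + gridBond h w (c, d) (a, b) ≠ 0 := Iff.rfl
  rw [h1, squareGrid, SimpleGraph.boxProd_adj, SimpleGraph.pathGraph_adj,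
    SimpleGraph.pathGraph_adj]
  simp only [gridBond, Fin.ext_iff]
  have ha := hh a b
  have hc := hh c d
  have hb' := b.2
  have hd' := d.2
  constructor
  · intro h2
    by_contra h3
    apply h2
    rw [if_neg (by omega), if_neg (by omega), if_neg (by omega), if_neg (by omega)]
    simp
  · rintro (⟨h2 | h2, h3⟩ | ⟨h2 | h2, h3⟩)
    · rw [if_neg (by omega), if_pos (by omega), if_neg (by omega), if_neg (by omega)]
      simpa using hw _ _
    · rw [if_neg (by omega), if_neg (by omega), if_neg (by omega), if_pos (by omega)]
      simpa using hw _ _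
    · rw [if_pos (by omega), if_neg (by omega), if_neg (by omega), if_neg (by omega)]
      simpa using ha (by omega)
    · rw [if_neg (by omega), if_neg (by omega), if_pos (by omega), if_neg (by omega)]
      simpa using hc (by omega)

theorem sum_grid_eq_sum_range {N : ℕ} (F : ℕ → ℕ → ℝ) :
    ∑ u : Fin N × Fin N, F u.1 u.2 = ∑ t ∈ Finset.range N, ∑ j ∈ Finset.range N, F t j := by
  rw [Fintype.sum_prod_type, Finset.sum_range]
  exact Finset.sum_congr rfl fun a _ => by rw [Finset.sum_range]

theorem sum_range_range_ite {N : ℕ} (a b : ℕ) (F : ℕ → ℕ → ℝ) :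
    ∑ c ∈ Finset.range N, ∑ d ∈ Finset.range N, (if a = c ∧ b = d then F c d else 0) =
      if a < N ∧ b < N then F a b else 0 := by
  simp [ite_and, Finset.sum_ite_eq]

theorem gridHamiltonian_energy {T : ℕ} (h w M : ℕ → ℕ → ℝ)
    (b : Fin (T + 1) × Fin (T + 1) → Bool) (s : ℕ → ℕ → ℝ)
    (hs : ∀ u, spinValue (b u) = s u.1 u.2) :
    (gridHamiltonian (T + 1) h w M).energy b =
      ∑ t ∈ Finset.range (T + 1), ∑ j ∈ Finset.range T, h t j * (s t j * s t (j + 1)) +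
      ∑ t ∈ Finset.range T, ∑ j ∈ Finset.range (T + 1), w t j * (s t j * s (t + 1) j) +
      ∑ t ∈ Finset.range (T + 1), ∑ j ∈ Finset.range (T + 1), M t j * s t j := by
  have key : ∑ u, ∑ v, gridBond h w u v * spinValue (b u) * spinValue (b v) =
      ∑ t ∈ Finset.range (T + 1), ∑ j ∈ Finset.range T, h t j * (s t j * s t (j + 1)) +
      ∑ t ∈ Finset.range T, ∑ j ∈ Finset.range (T + 1), w t j * (s t j * s (t + 1) j) := by
    have inner : ∀ u : Fin (T + 1) × Fin (T + 1),
        ∑ v, gridBond h w u v * spinValue (b u) * spinValue (b v) =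
        (if (u.2 : ℕ) < T then h u.1 u.2 * (s u.1 u.2 * s u.1 (u.2 + 1)) else 0) +
        (if (u.1 : ℕ) < T then w u.1 u.2 * (s u.1 u.2 * s (u.1 + 1) u.2) else 0) := by
      intro u
      have e1 := sum_range_range_ite (N := T + 1) u.1 (u.2 + 1)
        (fun c d => h u.1 u.2 * (s u.1 u.2 * s c d))
      have e2 := sum_range_range_ite (N := T + 1) (u.1 + 1) u.2
        (fun c d => w u.1 u.2 * (s u.1 u.2 * s c d))
      rw [← sum_grid_eq_sum_range] at e1 e2
      have h1 := u.1.2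
      have h2 := u.2.2
      simp only [h1, h2, true_and, and_true, Nat.add_lt_add_iff_right] at e1 e2
      rw [← e1, ← e2, ← Finset.sum_add_distrib]
      refine Finset.sum_congr rfl fun v _ => ?_
      rw [hs u, hs v, gridBond]
      split_ifs <;> ring
    rw [Finset.sum_congr rfl fun u _ => inner u, Finset.sum_add_distrib,
      sum_grid_eq_sum_range (N := T + 1)
        (fun t j => if j < T then h t j * (s t j * s t (j + 1)) else 0),
      sum_grid_eq_sum_range (N := T + 1)
        (fun t j => if t < T then w t j * (s t j * s (t + 1) j) else 0)]
    congr 1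
    · refine Finset.sum_congr rfl fun t _ => ?_
      rw [Finset.sum_range_succ]
      simp only [lt_self_iff_false, if_false, add_zero]
      exact Finset.sum_congr rfl fun j hj => if_pos (Finset.mem_range.1 hj)
    · rw [Finset.sum_range_succ]
      simp only [lt_self_iff_false, if_false, Finset.sum_const_zero, add_zero]
      exact Finset.sum_congr rfl fun t ht => Finset.sum_congr rfl fun j _ =>
        if_pos (Finset.mem_range.1 ht)
  have key' : ∑ u, ∑ v, (gridHamiltonian (T + 1) h w M).coupling u v *
      spinValue (b u) * spinValue (b v) =
      2 * ∑ u, ∑ v, gridBond h w u v * spinValue (b u) * spinValue (b v) := by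
    have swap : ∑ u, ∑ v, gridBond h w v u * spinValue (b u) * spinValue (b v) =
        ∑ u, ∑ v, gridBond h w u v * spinValue (b u) * spinValue (b v) := by
      rw [Finset.sum_comm]
      exact Finset.sum_congr rfl fun u _ => Finset.sum_congr rfl fun v _ => by ring
    rw [two_mul]
    nth_rewrite 2 [← swap]
    rw [← Finset.sum_add_distrib]
    refine Finset.sum_congr rfl fun u _ => ?_
    rw [← Finset.sum_add_distrib]
    exact Finset.sum_congr rfl fun v _ => by simp only [gridHamiltonian]; ring
  rw [IsingHamiltonian.energy, key', mul_div_cancel_left₀ _ two_ne_zero, key,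
    ← sum_grid_eq_sum_range (fun t j => M t j * s t j)]
  congr 1
  exact Finset.sum_congr rfl fun u _ => by rw [hs]; rfl

/-! ### Plaquette gadgets -/

/-- The gates of a brickwork network; each acts on two neighbouring columns. -/
inductive Brick : Type
  | wire
  | norLeft
  | norRight

namespace Brick

/-- The new value of the left column. -/
def left : Brick → Bool → Bool → Bool
  | norLeft, x, y => !(x || y)
  | _, x, _ => x

/-- The new value of the right column. -/
def right : Brick → Bool → Bool → Bool
  | norRight, x, y => !(x || y)
  | _, _, y => y

end Brick

/-- A quadratic energy on two spins, one above the other. -/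
structure VerticalBond where
  coupling : ℝ
  top : ℝ
  bottom : ℝ

namespace VerticalBond

/-- The energy of a vertical bond. -/
def eval (B : VerticalBond) (x z : ℝ) : ℝ := B.coupling * (x * z) + B.top * x + B.bottom * z

/-- The bond that penalizes distinct values. -/
def wire : VerticalBond := ⟨-4, 2, 2⟩

end VerticalBond

namespace Brick

/-- The bond on the left side of the plaquette that realizes a gate. -/
def leftBond : Brick → VerticalBond
  | wire => .wire
  | norLeft => ⟨2, -1, -1⟩
  | norRight => ⟨-4, 2, 1⟩

/-- The bond on the right side of the plaquette that realizes a gate. -/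
def rightBond : Brick → VerticalBond
  | wire => .wire
  | norLeft => ⟨-4, 2, 1⟩
  | norRight => ⟨2, -1, -1⟩

/-- The interaction on the bottom side of the plaquette that realizes a gate. -/
def bottomCoupling : Brick → ℝ
  | wire => -1
  | _ => 2

/-- The constant that makes the least energy of a plaquette equal to zero. -/
def offset : Brick → ℝ
  | wire => 0
  | _ => 1

/-- The energy of the plaquette with top spins `x`, `y` and bottom spins `z`, `w`. -/
def penalty (g : Brick) (x y z w : ℝ) : ℝ :=
  x * y + g.bottomCoupling * (z * w) + g.leftBond.eval x z + g.rightBond.eval y w + g.offset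

theorem penalty_nonneg (g : Brick) (x y z w : Bool) :
    0 ≤ g.penalty (spinValue x) (spinValue y) (spinValue z) (spinValue w) := by
  cases g <;> cases x <;> cases y <;> cases z <;> cases w <;>
    norm_num [penalty, spinValue, leftBond, rightBond, bottomCoupling, offset,
      VerticalBond.eval, VerticalBond.wire]

/-- For a wire, copying errors cost at least 2, while `x * y - z * w` is at least -1 and cancels on
exact copies. For `norLeft`, the NOR penalty `1 - x - y - z + x * y + 2 * x * z + 2 * y * z` needs
the diagonal term `y * z`, which is no edge; since `w` copies `y`, the bottom edge supplies it as `z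
* w`, and `-y` becomes the field `-w`. The remaining finite check is by cases; `norRight` is the
mirror image. -/
theorem penalty_eq_zero_iff (g : Brick) (x y z w : Bool) :
    g.penalty (spinValue x) (spinValue y) (spinValue z) (spinValue w) = 0 ↔
      z = g.left x y ∧ w = g.right x y := by
  cases g <;> cases x <;> cases y <;> cases z <;> cases w <;>
    norm_num [penalty, spinValue, leftBond, rightBond, bottomCoupling, offset, left, right,
      VerticalBond.eval, VerticalBond.wire]

end Brick

theorem VerticalBond.wire_eval_nonneg (x z : Bool) :
    0 ≤ VerticalBond.wire.eval (spinValue x) (spinValue z) := by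
  cases x <;> cases z <;> norm_num [eval, wire, spinValue]

theorem VerticalBond.wire_eval_eq_zero_iff (x z : Bool) :
    VerticalBond.wire.eval (spinValue x) (spinValue z) = 0 ↔ z = x := by
  cases x <;> cases z <;> norm_num [eval, wire, spinValue]

/-! ### The brickwork Hamiltonian as a sum of penalties -/

/-- The vertical bond between the rows `t` and `t + 1` in column `j`, in the network with gate
`g t j` on the columns `j`, `j + 1` of the layer `t` whenever `t + j` is even. -/
def brickworkBond (g : ℕ → ℕ → Brick) (t : ℕ) : ℕ → VerticalBond
  | 0 => if t % 2 = 0 then (g t 0).leftBond else .wire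
  | j + 1 => if (t + (j + 1)) % 2 = 0 then (g t (j + 1)).leftBond else (g t j).rightBond

/-- The horizontal interactions of a brickwork network. -/
def brickworkCoupling (g : ℕ → ℕ → Brick) : ℕ → ℕ → ℝ
  | 0, _ => 1
  | t + 1, j => if (t + 1 + j) % 2 = 0 then 1 else (g t j).bottomCoupling

/-- The external field of a brickwork network with `T` layers, where `init` is the additional
field on the first row. -/
noncomputable def brickworkField (g : ℕ → ℕ → Brick) (T : ℕ) (init : ℕ → ℝ) (t j : ℕ) : ℝ :=
  (if t < T then (brickworkBond g t j).top else 0) +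
    match t with
    | 0 => init j
    | t + 1 => (brickworkBond g t j).bottom

theorem brickworkBond_coupling_ne_zero (g : ℕ → ℕ → Brick) (t j : ℕ) :
    (brickworkBond g t j).coupling ≠ 0 := by
  have h1 : ∀ b : Brick, b.leftBond.coupling ≠ 0 := by
    intro b; cases b <;> norm_num [Brick.leftBond, VerticalBond.wire]
  have h2 : ∀ b : Brick, b.rightBond.coupling ≠ 0 := by
    intro b; cases b <;> norm_num [Brick.rightBond, VerticalBond.wire]
  cases j with
  | zero =>
    rw [brickworkBond]
    split_ifs
    · exact h1 _
    · norm_num [VerticalBond.wire]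
  | succ j =>
    rw [brickworkBond]
    split_ifs
    · exact h1 _
    · exact h2 _

theorem brickworkCoupling_ne_zero (g : ℕ → ℕ → Brick) (t j : ℕ) :
    brickworkCoupling g t j ≠ 0 := by
  have h1 : ∀ b : Brick, b.bottomCoupling ≠ 0 := by
    intro b; cases b <;> norm_num [Brick.bottomCoupling]
  cases t with
  | zero => norm_num [brickworkCoupling]
  | succ t =>
    rw [brickworkCoupling]
    split_ifs
    · norm_num
    · exact h1 _

/-- The Hamiltonian of a brickwork network with `T` layers on the square grid. -/
noncomputable def brickworkHamiltonian (g : ℕ → ℕ → Brick) (T : ℕ) (init : ℕ → ℝ) :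
    IsingHamiltonian (Fin (T + 1) × Fin (T + 1)) :=
  gridHamiltonian (T + 1) (brickworkCoupling g) (fun t j => (brickworkBond g t j).coupling)
    (brickworkField g T init)

theorem brickworkHamiltonian_isSquare (g : ℕ → ℕ → Brick) (T : ℕ) (init : ℕ → ℝ) :
    (brickworkHamiltonian g T init).IsSquare :=
  gridHamiltonian_isSquare _ (fun t j _ => brickworkCoupling_ne_zero g t j)
    (brickworkBond_coupling_ne_zero g)

/-- The energy of the plaquettes and of the boundary bonds between the rows `t` and `t + 1`. -/
def layerPenalty (g : ℕ → ℕ → Brick) (T : ℕ) (s : ℕ → ℕ → ℝ) (t : ℕ) : ℝ :=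
  ∑ j ∈ Finset.range T, (if (t + j) % 2 = 0 then
      (g t j).penalty (s t j) (s t (j + 1)) (s (t + 1) j) (s (t + 1) (j + 1)) else 0) +
    (if (t + T) % 2 = 0 then (g t T).leftBond.eval (s t T) (s (t + 1) T) else 0) +
    (if t % 2 = 0 then 0 else VerticalBond.wire.eval (s t 0) (s (t + 1) 0))

/-- The energy of the interactions in the first row that belong to no plaquette, and of the
additional field. -/
def firstRowPenalty (T : ℕ) (init : ℕ → ℝ) (s : ℕ → ℕ → ℝ) : ℝ :=
  ∑ j ∈ Finset.range (T + 1), init j * s 0 j +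
    ∑ j ∈ Finset.range T, (if (0 + j) % 2 = 0 then 0 else s 0 j * s 0 (j + 1))

/-- The energy of the interactions in the last row that belong to no plaquette. -/
def lastRowPenalty (T : ℕ) (s : ℕ → ℕ → ℝ) : ℝ :=
  ∑ j ∈ Finset.range T, (if (T + j) % 2 = 0 then s T j * s T (j + 1) else 0)

/-- The total offset of the plaquettes. -/
def brickworkOffset (g : ℕ → ℕ → Brick) (T : ℕ) : ℝ :=
  ∑ t ∈ Finset.range T, ∑ j ∈ Finset.range T, (if (t + j) % 2 = 0 then (g t j).offset else 0)

/-- A column's bond is the left side of the plaquette starting there or the right side of the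
preceding one, according to parity. Two cases lack a partner: column `W` with `t + W` even, and
column 0 with `t` odd. -/
theorem sum_brickworkBond (g : ℕ → ℕ → Brick) (t : ℕ) (x z : ℕ → ℝ) (W : ℕ) :
    ∑ j ∈ Finset.range (W + 1), (brickworkBond g t j).eval (x j) (z j) =
      ∑ j ∈ Finset.range W, (if (t + j) % 2 = 0 then
        (g t j).leftBond.eval (x j) (z j) + (g t j).rightBond.eval (x (j + 1)) (z (j + 1))
        else 0) +
      (if (t + W) % 2 = 0 then (g t W).leftBond.eval (x W) (z W) else 0) +
      (if t % 2 = 0 then 0 else VerticalBond.wire.eval (x 0) (z 0)) := by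
  induction W with
  | zero =>
    simp only [zero_add, Finset.sum_range_one, Finset.sum_range_zero, add_zero, brickworkBond]
    split_ifs <;> simp
  | succ W ih =>
    rw [Finset.sum_range_succ, ih, Finset.sum_range_succ _ W, brickworkBond]
    rcases Nat.mod_two_eq_zero_or_one (t + W) with h | h
    · have h' : ¬ (t + (W + 1)) % 2 = 0 := by omega
      simp only [h, h', if_true, if_false]
      ring
    · have h' : (t + (W + 1)) % 2 = 0 := by omega
      have h'' : ¬ (t + W) % 2 = 0 := by omega
      simp only [h'', h', if_true, if_false]
      ring

theorem brickworkHamiltonian_energy (g : ℕ → ℕ → Brick) (T : ℕ) (init : ℕ → ℝ)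
    (b : Fin (T + 1) × Fin (T + 1) → Bool) (s : ℕ → ℕ → ℝ)
    (hs : ∀ u, spinValue (b u) = s u.1 u.2) :
    (brickworkHamiltonian g T init).energy b + brickworkOffset g T =
      ∑ t ∈ Finset.range T, layerPenalty g T s t + firstRowPenalty T init s +
        lastRowPenalty T s := by
  rw [brickworkHamiltonian, gridHamiltonian_energy _ _ _ b s hs]
  have layer : ∀ t, layerPenalty g T s t =
      ∑ j ∈ Finset.range T, (if (t + j) % 2 = 0 then s t j * s t (j + 1) else 0) +
      ∑ j ∈ Finset.range T, (if (t + j) % 2 = 0 then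
        (g t j).bottomCoupling * (s (t + 1) j * s (t + 1) (j + 1)) else 0) +
      ∑ j ∈ Finset.range (T + 1), (brickworkBond g t j).eval (s t j) (s (t + 1) j) +
      ∑ j ∈ Finset.range T, (if (t + j) % 2 = 0 then (g t j).offset else 0) := by
    intro t
    rw [sum_brickworkBond, layerPenalty]
    have : ∑ j ∈ Finset.range T, (if (t + j) % 2 = 0 then
        (g t j).penalty (s t j) (s t (j + 1)) (s (t + 1) j) (s (t + 1) (j + 1)) else 0) =
        ∑ j ∈ Finset.range T, (if (t + j) % 2 = 0 then s t j * s t (j + 1) else 0) +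
        ∑ j ∈ Finset.range T, (if (t + j) % 2 = 0 then
          (g t j).bottomCoupling * (s (t + 1) j * s (t + 1) (j + 1)) else 0) +
        ∑ j ∈ Finset.range T, (if (t + j) % 2 = 0 then (g t j).leftBond.eval (s t j) (s (t + 1) j) +
          (g t j).rightBond.eval (s t (j + 1)) (s (t + 1) (j + 1)) else 0) +
        ∑ j ∈ Finset.range T, (if (t + j) % 2 = 0 then (g t j).offset else 0) := by
      simp only [← Finset.sum_add_distrib]
      refine Finset.sum_congr rfl fun j _ => ?_
      split_ifs
      · rw [Brick.penalty]; ring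
      · ring
    rw [this]
    ring
  have horizontal : ∑ t ∈ Finset.range (T + 1), ∑ j ∈ Finset.range T,
      brickworkCoupling g t j * (s t j * s t (j + 1)) =
      ∑ t ∈ Finset.range T,
        ∑ j ∈ Finset.range T, (if (t + j) % 2 = 0 then s t j * s t (j + 1) else 0) +
      ∑ t ∈ Finset.range T, ∑ j ∈ Finset.range T, (if (t + j) % 2 = 0 then
        (g t j).bottomCoupling * (s (t + 1) j * s (t + 1) (j + 1)) else 0) +
      ∑ j ∈ Finset.range T, (if (0 + j) % 2 = 0 then 0 else s 0 j * s 0 (j + 1)) +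
      lastRowPenalty T s := by
    have split : ∀ t, ∑ j ∈ Finset.range T, brickworkCoupling g t j * (s t j * s t (j + 1)) =
        ∑ j ∈ Finset.range T, (if (t + j) % 2 = 0 then s t j * s t (j + 1) else 0) +
        ∑ j ∈ Finset.range T, (if (t + j) % 2 = 0 then 0
          else brickworkCoupling g t j * (s t j * s t (j + 1))) := by
      intro t
      rw [← Finset.sum_add_distrib]
      refine Finset.sum_congr rfl fun j _ => ?_
      split_ifs with h
      · cases t <;> simp [brickworkCoupling, h]
      · ring
    have step : ∀ t, ∑ j ∈ Finset.range T, (if (t + 1 + j) % 2 = 0 then 0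
          else brickworkCoupling g (t + 1) j * (s (t + 1) j * s (t + 1) (j + 1))) =
        ∑ j ∈ Finset.range T, (if (t + j) % 2 = 0 then
          (g t j).bottomCoupling * (s (t + 1) j * s (t + 1) (j + 1)) else 0) := by
      intro t
      refine Finset.sum_congr rfl fun j _ => ?_
      rcases Nat.mod_two_eq_zero_or_one (t + j) with h | h
      · have h' : ¬ (t + 1 + j) % 2 = 0 := by omega
        simp [h, h', brickworkCoupling]
      · have h' : (t + 1 + j) % 2 = 0 := by omega
        simp [h, h']
    simp only [split]
    -- Edges with `t + j` even are tops of layer `t`, so row `T` is left over; the others are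
    -- bottoms of layer `t - 1`, so row 0 is left over.
    rw [Finset.sum_add_distrib, Finset.sum_range_succ, Finset.sum_range_succ' _ T]
    simp only [step]
    have first : ∑ j ∈ Finset.range T, (if (0 + j) % 2 = 0 then (0 : ℝ)
        else brickworkCoupling g 0 j * (s 0 j * s 0 (j + 1))) =
        ∑ j ∈ Finset.range T, (if (0 + j) % 2 = 0 then 0 else s 0 j * s 0 (j + 1)) := by
      simp [brickworkCoupling]
    rw [first, lastRowPenalty]
    ring
  have field : ∑ t ∈ Finset.range (T + 1), ∑ j ∈ Finset.range (T + 1),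
      brickworkField g T init t j * s t j =
      ∑ t ∈ Finset.range T, ∑ j ∈ Finset.range (T + 1), (brickworkBond g t j).top * s t j +
      ∑ t ∈ Finset.range T, ∑ j ∈ Finset.range (T + 1),
        (brickworkBond g t j).bottom * s (t + 1) j +
      ∑ j ∈ Finset.range (T + 1), init j * s 0 j := by
    simp only [brickworkField, add_mul, Finset.sum_add_distrib]
    rw [add_assoc]
    congr 1
    · rw [Finset.sum_range_succ]
      simp only [lt_self_iff_false, if_false, zero_mul, Finset.sum_const_zero, add_zero]
      exact Finset.sum_congr rfl fun t ht => by simp only [if_pos (Finset.mem_range.1 ht)]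
    · exact Finset.sum_range_succ' _ T
  rw [horizontal, field]
  simp only [layer, Finset.sum_add_distrib, VerticalBond.eval, firstRowPenalty, brickworkOffset]
  ring

/-! ### Ground states as histories -/

/-- The action of the layer `t` of a brickwork network on a row of the grid. -/
def layerStep (g : ℕ → ℕ → Brick) (t : ℕ) (r : ℕ → Bool) : ℕ → Bool
  | 0 => if t % 2 = 0 then (g t 0).left (r 0) (r 1) else r 0
  | j + 1 => if (t + (j + 1)) % 2 = 0 then (g t (j + 1)).left (r (j + 1)) (r (j + 2))
      else (g t j).right (r j) (r (j + 1))

/-- The row after `t` layers of a brickwork network, starting from the row `r`. -/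
def evolve (g : ℕ → ℕ → Brick) (r : ℕ → Bool) : ℕ → ℕ → Bool
  | 0 => r
  | t + 1 => layerStep g t (evolve g r t)

/-- The wire in column `T` keeps the layer from reading column `T + 1`, which lies outside the grid.
-/
theorem layerStep_congr {g : ℕ → ℕ → Brick} {t T : ℕ} (hg : g t T = .wire) {r r' : ℕ → Bool}
    (h : ∀ j ≤ T, r j = r' j) : ∀ j ≤ T, layerStep g t r j = layerStep g t r' j := by
  intro j hj
  cases j with
  | zero =>
    rw [layerStep, layerStep]
    rcases Nat.eq_zero_or_pos T with rfl | hT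
    · rw [hg, Brick.left, Brick.left, h 0 le_rfl]
      all_goals simp
    · rw [h 0 (by omega), h 1 (by omega)]
  | succ j =>
    rw [layerStep, layerStep, h (j + 1) hj, h j (by omega)]
    rcases Nat.lt_or_ge (j + 1) T with hT | hT
    · rw [h (j + 2) (by omega)]
    · obtain rfl : j + 1 = T := by omega
      simp [hg, Brick.left]

theorem spinValue_nonneg (b : Bool) : 0 ≤ spinValue b := by
  cases b <;> norm_num [spinValue]

section

variable {g : ℕ → ℕ → Brick} {T : ℕ} {b : ℕ → ℕ → Bool}

theorem layerPenalty_nonneg {t : ℕ} (hg : g t T = .wire) :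
    0 ≤ layerPenalty g T (fun t j => spinValue (b t j)) t := by
  rw [layerPenalty, hg]
  refine add_nonneg (add_nonneg (Finset.sum_nonneg fun j _ => ?_) ?_) ?_
  · split_ifs
    · exact Brick.penalty_nonneg _ _ _ _ _
    · exact le_rfl
  · split_ifs
    · exact VerticalBond.wire_eval_nonneg _ _
    · exact le_rfl
  · split_ifs
    · exact le_rfl
    · exact VerticalBond.wire_eval_nonneg _ _

/-- All summands are nonnegative, so each must vanish; every column is governed by one plaquette or
by one boundary wire. -/
theorem layerPenalty_eq_zero_iff {t : ℕ} (hg : g t T = .wire) :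
    layerPenalty g T (fun t j => spinValue (b t j)) t = 0 ↔
      ∀ j ≤ T, b (t + 1) j = layerStep g t (b t) j := by
  have n1 : ∀ j ∈ Finset.range T, 0 ≤ (if (t + j) % 2 = 0 then
      (g t j).penalty (spinValue (b t j)) (spinValue (b t (j + 1))) (spinValue (b (t + 1) j))
        (spinValue (b (t + 1) (j + 1))) else 0) := by
    intro j _
    split_ifs
    · exact Brick.penalty_nonneg _ _ _ _ _
    · exact le_rfl
  have n2 : 0 ≤ (if (t + T) % 2 = 0 then
      VerticalBond.wire.eval (spinValue (b t T)) (spinValue (b (t + 1) T)) else 0) := by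
    split_ifs
    · exact VerticalBond.wire_eval_nonneg _ _
    · exact le_rfl
  have n3 : 0 ≤ (if t % 2 = 0 then 0 else
      VerticalBond.wire.eval (spinValue (b t 0)) (spinValue (b (t + 1) 0))) := by
    split_ifs
    · exact le_rfl
    · exact VerticalBond.wire_eval_nonneg _ _
  have hb : (g t T).leftBond = .wire := by rw [hg]; rfl
  rw [layerPenalty, hb, add_eq_zero_iff_of_nonneg (add_nonneg (Finset.sum_nonneg n1) n2) n3,
    add_eq_zero_iff_of_nonneg (Finset.sum_nonneg n1) n2, Finset.sum_eq_zero_iff_of_nonneg n1]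
  constructor
  · rintro ⟨⟨h1, h2⟩, h3⟩ j hj
    have p1 : ∀ j < T, (t + j) % 2 = 0 → b (t + 1) j = (g t j).left (b t j) (b t (j + 1)) ∧
        b (t + 1) (j + 1) = (g t j).right (b t j) (b t (j + 1)) := by
      intro j hj he
      have := h1 j (Finset.mem_range.2 hj)
      rwa [if_pos he, Brick.penalty_eq_zero_iff] at this
    have p2 : (t + T) % 2 = 0 → b (t + 1) T = b t T := by
      intro he
      rwa [if_pos he, VerticalBond.wire_eval_eq_zero_iff] at h2
    have p3 : ¬ t % 2 = 0 → b (t + 1) 0 = b t 0 := by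
      intro he
      rwa [if_neg he, VerticalBond.wire_eval_eq_zero_iff] at h3
    cases j with
    | zero =>
      rw [layerStep]
      split_ifs with he
      · rcases Nat.eq_zero_or_pos T with rfl | hT
        · rw [p2 (by omega), hg, Brick.left]
          all_goals simp
        · exact (p1 0 hT (by omega)).1
      · exact p3 he
    | succ j =>
      rw [layerStep]
      split_ifs with he
      · rcases Nat.lt_or_ge (j + 1) T with hT | hT
        · exact (p1 (j + 1) hT he).1
        · obtain rfl : j + 1 = T := by omega
          rw [p2 he, hg, Brick.left]
          all_goals simp
      · exact (p1 j (by omega) (by omega)).2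
  · intro h
    refine ⟨⟨fun j hj => ?_, ?_⟩, ?_⟩
    · rw [Finset.mem_range] at hj
      split_ifs with he
      · rw [Brick.penalty_eq_zero_iff]
        constructor
        · rw [h j (by omega)]
          cases j with
          | zero => rw [layerStep, if_pos (by omega)]
          | succ j => rw [layerStep, if_pos (by omega)]
        · rw [h (j + 1) (by omega), layerStep, if_neg (by omega)]
      · rfl
    · split_ifs with he
      · rw [VerticalBond.wire_eval_eq_zero_iff, h T le_rfl]
        cases T with
        | zero => rw [layerStep, if_pos (by omega), hg]; rfl
        | succ j => rw [layerStep, if_pos (by omega), hg]; rfl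
      · rfl
    · split_ifs with he
      · rfl
      · rw [VerticalBond.wire_eval_eq_zero_iff, h 0 (by omega), layerStep, if_neg he]

theorem firstRowPenalty_nonneg {init : ℕ → ℝ} (h0 : ∀ j, 0 ≤ init j) :
    0 ≤ firstRowPenalty T init (fun t j => spinValue (b t j)) := by
  refine add_nonneg (Finset.sum_nonneg fun j _ => mul_nonneg (h0 j) (spinValue_nonneg _))
    (Finset.sum_nonneg fun j _ => ?_)
  split_ifs
  · exact le_rfl
  · exact mul_nonneg (spinValue_nonneg _) (spinValue_nonneg _)

theorem lastRowPenalty_nonneg : 0 ≤ lastRowPenalty T (fun t j => spinValue (b t j)) := by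
  refine Finset.sum_nonneg fun j _ => ?_
  split_ifs
  · exact mul_nonneg (spinValue_nonneg _) (spinValue_nonneg _)
  · exact le_rfl

/-- Every horizontal edge has an endpoint in an odd column. -/
theorem lastRowPenalty_eq_zero (h : ∀ j ≤ T, j % 2 = 1 → b T j = false) :
    lastRowPenalty T (fun t j => spinValue (b t j)) = 0 := by
  refine Finset.sum_eq_zero fun j hj => ?_
  rw [Finset.mem_range] at hj
  rcases Nat.mod_two_eq_zero_or_one j with h1 | h1
  · simp [h (j + 1) (by omega) (by omega), spinValue]
  · simp [h j (by omega) (by omega), spinValue]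

/-- The field alone forces the zeros. The leftover couplings then vanish for free, as their left
endpoints are in odd columns, where `p` fails. -/
theorem firstRowPenalty_eq_zero_iff (p : ℕ → Prop) [DecidablePred p]
    (hp : ∀ j, p j → j % 2 = 0) :
    firstRowPenalty T (fun j => if p j then 0 else 1) (fun t j => spinValue (b t j)) = 0 ↔
      ∀ j ≤ T, ¬ p j → b 0 j = false := by
  have n1 : ∀ j ∈ Finset.range (T + 1), 0 ≤ (if p j then (0 : ℝ) else 1) * spinValue (b 0 j) := by
    intro j _
    refine mul_nonneg ?_ (spinValue_nonneg _)
    split_ifs <;> norm_num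
  have n2 : ∀ j ∈ Finset.range T,
      0 ≤ (if (0 + j) % 2 = 0 then 0 else spinValue (b 0 j) * spinValue (b 0 (j + 1))) := by
    intro j _
    split_ifs
    · exact le_rfl
    · exact mul_nonneg (spinValue_nonneg _) (spinValue_nonneg _)
  rw [firstRowPenalty, add_eq_zero_iff_of_nonneg (Finset.sum_nonneg n1) (Finset.sum_nonneg n2),
    Finset.sum_eq_zero_iff_of_nonneg n1, Finset.sum_eq_zero_iff_of_nonneg n2]
  constructor
  · rintro ⟨h1, -⟩ j hj hpj
    have := h1 j (Finset.mem_range.2 (by omega))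
    rw [if_neg hpj] at this
    cases hb : b 0 j
    · rfl
    · norm_num [hb, spinValue] at this
  · intro h
    refine ⟨fun j hj => ?_, fun j hj => ?_⟩ <;> rw [Finset.mem_range] at hj
    · split_ifs with hpj
      · simp
      · simp [h j (by omega) hpj, spinValue]
    · split_ifs with he
      · rfl
      · have : b 0 j = false := h j (by omega) fun hpj => he (by have := hp j hpj; omega)
        simp [this, spinValue]

end

/-- The extension of a state of the grid by zeros. -/
def extendState {N : ℕ} (b : Fin N × Fin N → Bool) (t j : ℕ) : Bool :=
  if h : t < N ∧ j < N then b (⟨t, h.1⟩, ⟨j, h.2⟩) else false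

theorem extendState_val {N : ℕ} (b : Fin N × Fin N → Bool) (u : Fin N × Fin N) :
    extendState b u.1 u.2 = b u := by
  simp [extendState]

theorem brickwork_isGroundState_iff {g : ℕ → ℕ → Brick} {T : ℕ} (hg : ∀ t, g t T = .wire)
    (p : ℕ → Prop) [DecidablePred p] (hp : ∀ j, p j → j % 2 = 0)
    (hodd : ∀ r : ℕ → Bool, (∀ j, ¬ p j → r j = false) →
      ∀ j ≤ T, j % 2 = 1 → evolve g r T j = false)
    (b : Fin (T + 1) × Fin (T + 1) → Bool) :
    (brickworkHamiltonian g T (fun j => if p j then 0 else 1)).IsGroundState b ↔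
      ∃ r : ℕ → Bool, (∀ j, ¬ p j → r j = false) ∧
        ∀ u, b u = evolve g r u.1 u.2 := by
  set H := brickworkHamiltonian g T (fun j => if p j then 0 else 1)
  have henergy : ∀ (b : Fin (T + 1) × Fin (T + 1) → Bool) (c : ℕ → ℕ → Bool),
      (∀ u, b u = c u.1 u.2) → H.energy b + brickworkOffset g T = _ := fun b c hc =>
    brickworkHamiltonian_energy g T (fun j => if p j then 0 else 1) b
      (fun t j => spinValue (c t j)) (fun u => by rw [hc u])
  have nl : ∀ c : ℕ → ℕ → Bool,
      0 ≤ ∑ t ∈ Finset.range T, layerPenalty g T (fun t j => spinValue (c t j)) t := fun c =>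
    Finset.sum_nonneg fun t _ => layerPenalty_nonneg (hg t)
  have nf : ∀ c : ℕ → ℕ → Bool, 0 ≤ firstRowPenalty T (fun j => if p j then 0 else 1)
      (fun t j => spinValue (c t j)) := fun c =>
    firstRowPenalty_nonneg fun j => by split_ifs <;> norm_num
  have lower : ∀ b, 0 ≤ H.energy b + brickworkOffset g T := by
    intro b
    rw [henergy b (extendState b) fun u => (extendState_val b u).symm]
    exact add_nonneg (add_nonneg (nl _) (nf _)) lastRowPenalty_nonneg
  have attained : ∀ (b : Fin (T + 1) × Fin (T + 1) → Bool) (r : ℕ → Bool),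
      (∀ j, ¬ p j → r j = false) → (∀ u, b u = evolve g r u.1 u.2) →
      H.energy b + brickworkOffset g T = 0 := by
    intro b r hr hb
    rw [henergy b (evolve g r) hb, lastRowPenalty_eq_zero (hodd r hr),
      (firstRowPenalty_eq_zero_iff p hp).2 fun j _ h => hr j h,
      Finset.sum_eq_zero fun t _ => (layerPenalty_eq_zero_iff (hg t)).2 fun j _ => rfl]
    norm_num
  constructor
  · intro h
    have h0 : H.energy b + brickworkOffset g T = 0 := by
      -- The history of the zero row attains the lower bound 0, so every ground state does.
      have h1 := h (fun u => evolve g (fun _ => false) u.1 u.2)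
      have h2 := attained _ (fun _ => false) (fun _ _ => rfl)
        (fun u : Fin (T + 1) × Fin (T + 1) => rfl)
      linarith [lower b]
    rw [henergy b (extendState b) fun u => (extendState_val b u).symm,
      add_eq_zero_iff_of_nonneg (add_nonneg (nl _) (nf _)) lastRowPenalty_nonneg,
      add_eq_zero_iff_of_nonneg (nl _) (nf _), Finset.sum_eq_zero_iff_of_nonneg
        fun t _ => layerPenalty_nonneg (hg t), firstRowPenalty_eq_zero_iff p hp] at h0
    obtain ⟨⟨h1, h2⟩, -⟩ := h0
    -- The penalties control only columns up to `T`; beyond them the default value `false` of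
    -- `extendState` gives the condition.
    refine ⟨extendState b 0, fun j hj => ?_, ?_⟩
    · by_cases hjT : j ≤ T
      · exact h2 j hjT hj
      · simp [extendState, show ¬ j < T + 1 by omega]
    · have : ∀ t ≤ T, ∀ j ≤ T, extendState b t j = evolve g (extendState b 0) t j := by
        intro t
        induction t with
        | zero => intro _ j _; rfl
        | succ t ih =>
          intro ht j hj
          rw [(layerPenalty_eq_zero_iff (hg t)).1 (h1 t (Finset.mem_range.2 ht)) j hj, evolve]
          exact layerStep_congr (hg t) (ih (by omega)) j hj
      intro u
      rw [← extendState_val b u]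
      exact this _ (by have := u.1.2; omega) _ (by have := u.2.2; omega)
  · rintro ⟨r, hr, hb⟩ b'
    linarith [lower b', attained b r hr hb]

/-! ### Sequential programs on a brickwork -/

/-- Apply a gate to the columns `j`, `j + 1` of a row. -/
def Brick.applyAt (j : ℕ) (g : Brick) (r : ℕ → Bool) (i : ℕ) : Bool :=
  if i = j then g.left (r j) (r (j + 1))
  else if i = j + 1 then g.right (r j) (r (j + 1)) else r i

/-- Apply a sequence of gates at prescribed columns to a row. -/
def runProgram (P : List (ℕ × Brick)) (r : ℕ → Bool) : ℕ → Bool :=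
  P.foldl (fun r q => q.2.applyAt q.1 r) r

theorem runProgram_append (P Q : List (ℕ × Brick)) (r : ℕ → Bool) :
    runProgram (P ++ Q) r = runProgram Q (runProgram P r) :=
  List.foldl_append

/-- The brickwork network that performs the step `k` of a program in the layers `2 * k` and
`2 * k + 1`. -/
def schedule (P : List (ℕ × Brick)) (t j : ℕ) : Brick :=
  match P[t / 2]? with
  | some q => if q.1 = j then q.2 else .wire
  | none => .wire

theorem layerStep_wire {g : ℕ → ℕ → Brick} {t : ℕ} (h : ∀ j, (t + j) % 2 = 0 → g t j = .wire)
    (r : ℕ → Bool) : layerStep g t r = r := by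
  funext j
  cases j with
  | zero =>
    rw [layerStep]
    split_ifs with he
    · rw [h 0 he]; rfl
    · rfl
  | succ j =>
    rw [layerStep]
    split_ifs with he
    · rw [h _ he]; rfl
    · rw [h j (by omega)]; rfl

theorem layerStep_schedule_of_even {P : List (ℕ × Brick)} {t : ℕ} {q : ℕ × Brick}
    (hq : P[t / 2]? = some q) (he : (t + q.1) % 2 = 0) (r : ℕ → Bool) :
    layerStep (schedule P) t r = q.2.applyAt q.1 r := by
  have hs : ∀ j, schedule P t j = if q.1 = j then q.2 else .wire := by
    intro j; rw [schedule, hq]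
  funext j
  cases j with
  | zero =>
    rw [layerStep, Brick.applyAt]
    by_cases h0 : q.1 = 0
    · rw [if_pos (by omega), if_pos h0.symm, hs, if_pos h0, h0]
    · rw [hs, if_neg h0, if_neg (Ne.symm h0), if_neg (Nat.succ_ne_zero _).symm]
      exact ite_self _
  | succ j =>
    rw [layerStep, Brick.applyAt]
    by_cases h0 : q.1 = j + 1
    · rw [if_pos (by omega), if_pos h0.symm, hs, if_pos h0, h0]
    · rw [if_neg (Ne.symm h0)]
      by_cases h1 : q.1 = j
      · rw [if_neg (by omega), if_pos (by omega), hs, if_pos h1, h1]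
      · rw [hs, hs, if_neg h0, if_neg h1, if_neg fun h => h1 (Nat.succ_injective h).symm]
        exact ite_self _

theorem layerStep_schedule_of_odd {P : List (ℕ × Brick)} {t : ℕ} {q : ℕ × Brick}
    (hq : P[t / 2]? = some q) (he : ¬ (t + q.1) % 2 = 0) (r : ℕ → Bool) :
    layerStep (schedule P) t r = r :=
  layerStep_wire (fun j hj => by
    rw [schedule, hq]
    exact if_neg fun h => he (by rw [h]; exact hj)) r

/-- Exactly one of the layers `2 * k`, `2 * k + 1` has the parity at which the column of step `k` is
active; the other layer is idle. -/
theorem evolve_schedule (P : List (ℕ × Brick)) (r : ℕ → Bool) (k : ℕ) :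
    evolve (schedule P) r (2 * k) = runProgram (P.take k) r := by
  induction k with
  | zero => rfl
  | succ k ih =>
    rw [show 2 * (k + 1) = 2 * k + 1 + 1 by ring, evolve, evolve, ih, List.take_add_one,
      runProgram_append]
    set r' := runProgram (P.take k) r
    have d0 : 2 * k / 2 = k := by omega
    have d1 : (2 * k + 1) / 2 = k := by omega
    rcases hq : P[k]? with _ | q
    · have h : ∀ t, t / 2 = k → layerStep (schedule P) t r' = r' := fun t ht =>
        layerStep_wire (fun j _ => by rw [schedule, ht, hq]) r'
      rw [h _ d0, h _ d1]
      rfl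
    · have hr : runProgram (some q).toList r' = q.2.applyAt q.1 r' := rfl
      rw [hr]
      rcases Nat.mod_two_eq_zero_or_one q.1 with h | h
      · rw [layerStep_schedule_of_even (t := 2 * k) (q := q) (by rw [d0, hq]) (by omega),
          layerStep_schedule_of_odd (t := 2 * k + 1) (q := q) (by rw [d1, hq]) (by omega)]
      · rw [layerStep_schedule_of_odd (t := 2 * k) (q := q) (by rw [d0, hq]) (by omega),
          layerStep_schedule_of_even (t := 2 * k + 1) (q := q) (by rw [d1, hq]) (by omega)]

/-! ### Operations on cells separated by zeros -/

/-- The row with `s k` in the column `2 * k`, and zeros in the odd columns. -/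
def interleave (s : ℕ → Bool) (j : ℕ) : Bool :=
  if j % 2 = 0 then s (j / 2) else false

/-- A transformation of cells can be performed, on interleaved rows, by a program of length at
most `L` that uses no column to the right of `B`. -/
def Implements (F : (ℕ → Bool) → ℕ → Bool) (L B : ℕ) : Prop :=
  ∃ P : List (ℕ × Brick), P.length ≤ L ∧ (∀ q ∈ P, q.1 < B) ∧
    ∀ s, runProgram P (interleave s) = interleave (F s)

theorem Implements.comp {F G : (ℕ → Bool) → ℕ → Bool} {L L' B B' : ℕ}
    (hG : Implements G L' B') (hF : Implements F L B) :
    Implements (fun s => G (F s)) (L + L') (max B B') := by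
  obtain ⟨P, hPl, hPB, hP⟩ := hF
  obtain ⟨Q, hQl, hQB, hQ⟩ := hG
  refine ⟨P ++ Q, by rw [List.length_append]; omega, fun q hq => ?_, fun s => ?_⟩
  · rcases List.mem_append.1 hq with h | h
    · exact lt_max_of_lt_left (hPB q h)
    · exact lt_max_of_lt_right (hQB q h)
  · rw [runProgram_append, hP, hQ]

theorem Implements.mono {F : (ℕ → Bool) → ℕ → Bool} {L L' B B' : ℕ} (h : Implements F L B)
    (hL : L ≤ L') (hB : B ≤ B') : Implements F L' B' := by
  obtain ⟨P, hPl, hPB, hP⟩ := h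
  exact ⟨P, hPl.trans hL, fun q hq => (hPB q hq).trans_le hB, hP⟩

/-- A row with prescribed values in the three columns from `c` on. -/
def window (r : ℕ → Bool) (c : ℕ) (v : Bool × Bool × Bool) (i : ℕ) : Bool :=
  if i = c then v.1 else if i = c + 1 then v.2.1 else if i = c + 2 then v.2.2 else r i

/-- Apply a gate to the left or to the right pair of three columns. -/
def windowStep (v : Bool × Bool × Bool) (q : Bool × Brick) : Bool × Bool × Bool :=
  if q.1 then (v.1, q.2.left v.2.1 v.2.2, q.2.right v.2.1 v.2.2)
  else (q.2.left v.1 v.2.1, q.2.right v.1 v.2.1, v.2.2)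

/-- The program that acts on the three columns from `c` on. -/
def shiftProgram (c : ℕ) (P : List (Bool × Brick)) : List (ℕ × Brick) :=
  P.map fun q => (c + q.1.toNat, q.2)

theorem runProgram_shiftProgram (r : ℕ → Bool) (c : ℕ) (P : List (Bool × Brick))
    (v : Bool × Bool × Bool) :
    runProgram (shiftProgram c P) (window r c v) = window r c (P.foldl windowStep v) := by
  induction P generalizing v with
  | nil => rfl
  | cons q P ih =>
    have h : q.2.applyAt (c + q.1.toNat) (window r c v) = window r c (windowStep v q) := by
      obtain ⟨p, g⟩ := q
      funext i
      cases p
      · simp only [Brick.applyAt, window, windowStep, Bool.toNat_false, add_zero]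
        by_cases h0 : i = c
        · simp [h0]
        · by_cases h1 : i = c + 1 <;> simp [h0, h1]
      · have e : c + 1 + 1 ≠ c := by omega
        simp only [Brick.applyAt, window, windowStep, Bool.toNat_true]
        by_cases h0 : i = c
        · simp [h0, e.symm]
        · by_cases h1 : i = c + 1
          · simp [h1, e]
          · by_cases h2 : i = c + 2 <;> simp [h0, h1, h2, e]
    rw [List.foldl_cons, ← ih, ← h]
    rfl

theorem interleave_eq_window (s s' : ℕ → Bool) (k : ℕ)
    (h : ∀ i, i ≠ k → i ≠ k + 1 → s' i = s i) :
    interleave s' = window (interleave s) (2 * k) (s' k, false, s' (k + 1)) := by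
  funext j
  simp only [interleave, window]
  by_cases h0 : j = 2 * k
  · simp [h0]
  · rw [if_neg h0]
    by_cases h1 : j = 2 * k + 1
    · rw [if_pos h1, if_neg (by omega)]
    · rw [if_neg h1]
      by_cases h2 : j = 2 * k + 2
      · rw [if_pos h2, if_pos (by omega), show j / 2 = k + 1 by omega]
      · rw [if_neg h2]
        split_ifs
        · exact h _ (by omega) (by omega)
        · rfl

theorem implements_of_window {F : (ℕ → Bool) → ℕ → Bool} {k L : ℕ} (P : List (Bool × Brick))
    (hL : P.length ≤ L) (hF : ∀ s i, i ≠ k → i ≠ k + 1 → F s i = s i)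
    (hP : ∀ s, P.foldl windowStep (s k, false, s (k + 1)) = (F s k, false, F s (k + 1))) :
    Implements F L (2 * (k + 1)) := by
  refine ⟨shiftProgram (2 * k) P, by simpa [shiftProgram] using hL, ?_, fun s => ?_⟩
  · intro q hq
    obtain ⟨a, -, rfl⟩ := List.mem_map.1 hq
    have := a.1.toNat_lt
    dsimp only
    omega
  · rw [interleave_eq_window s s k fun _ _ _ => rfl, runProgram_shiftProgram, hP,
      ← interleave_eq_window s (F s) k (hF s)]

/-- A program that exchanges the outer columns of three columns. -/
def swapProgram : List (Bool × Brick) :=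
  [(false, .norLeft), (true, .norLeft), (false, .norRight), (false, .norLeft), (true, .norRight),
   (true, .norRight), (true, .norLeft), (false, .norRight), (false, .norRight),
   (false, .norLeft), (true, .norRight), (true, .norLeft), (false, .norRight),
   (false, .norRight)]

/-- A program that applies the operation with a given truth table to the outer columns of three
columns, and stores the result in the right column. -/
def opProgram : (ff ft tf tt : Bool) → List (Bool × Brick)
  | false, false, false, false =>
    [(false, .norRight), (true, .norRight), (false, .norRight), (true, .norLeft),
     (true, .norRight), (false, .norRight)]
  | false, false, false, true =>
    [(false, .norRight), (true, .norRight), (true, .norRight), (false, .norRight)]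
  | false, false, true, false =>
    [(false, .norRight), (true, .norRight), (false, .norRight)]
  | false, false, true, true =>
    [(false, .norRight), (true, .norLeft), (true, .norRight), (false, .norRight),
     (true, .norRight), (true, .norLeft)]
  | false, true, false, false =>
    [(false, .norLeft), (false, .norRight), (true, .norRight), (true, .norRight),
     (false, .norRight), (false, .norLeft)]
  | false, true, false, true =>
    []
  | false, true, true, false =>
    [(true, .norLeft), (false, .norRight), (true, .norRight), (true, .norRight),
     (false, .norRight), (true, .norRight), (true, .norLeft), (false, .norRight),
     (false, .norRight)]
  | false, true, true, true =>
    [(false, .norLeft), (false, .norRight), (true, .norRight), (false, .norRight),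
     (false, .norLeft), (true, .norRight)]
  | true, false, false, false =>
    [(false, .norLeft), (false, .norRight), (true, .norRight), (false, .norRight),
     (false, .norLeft)]
  | true, false, false, true =>
    [(true, .norLeft), (false, .norRight), (false, .norRight), (true, .norRight),
     (false, .norRight), (true, .norRight), (true, .norLeft), (false, .norRight),
     (false, .norRight)]
  | true, false, true, false =>
    [(true, .norRight)]
  | true, false, true, true =>
    [(true, .norLeft), (true, .norRight), (false, .norRight), (true, .norRight),
     (true, .norLeft)]
  | true, true, false, false =>
    [(false, .norRight), (true, .norRight), (true, .norLeft), (true, .norRight),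
     (false, .norRight), (false, .norRight)]
  | true, true, false, true =>
    [(false, .norRight), (true, .norRight), (false, .norRight), (true, .norRight)]
  | true, true, true, false =>
    [(false, .norRight), (true, .norRight), (true, .norRight), (false, .norRight),
     (true, .norRight)]
  | true, true, true, true =>
    [(false, .norRight), (true, .norRight), (false, .norRight), (true, .norLeft),
     (true, .norRight), (false, .norRight), (true, .norRight)]

/-- The middle column is working space and is returned to `false`, so programs can be chained;
likewise for `opProgram`. -/
theorem swapProgram_spec (x y : Bool) :
    swapProgram.foldl windowStep (x, false, y) = (y, false, x) := by
  revert x y; decide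

theorem opProgram_spec (ff ft tf tt x y : Bool) :
    (opProgram ff ft tf tt).foldl windowStep (x, false, y) =
      (x, false, bif x then bif y then tt else tf else bif y then ft else ff) := by
  revert ff ft tf tt x y; decide

theorem opProgram_length (ff ft tf tt : Bool) : (opProgram ff ft tf tt).length ≤ 14 := by
  revert ff ft tf tt; decide

/-- Replace the cell `p` by the result of an operation on the cells `i` and `p`. -/
def combine (op : Bool → Bool → Bool) (i p : ℕ) (s : ℕ → Bool) : ℕ → Bool :=
  Function.update s p (op (s i) (s p))

theorem implements_combine_succ (op : Bool → Bool → Bool) (k : ℕ) :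
    Implements (combine op k (k + 1)) 14 (2 * (k + 1)) := by
  refine implements_of_window (opProgram (op false false) (op false true) (op true false)
    (op true true)) (opProgram_length _ _ _ _) ?_ ?_
  · intro s i _ h
    exact Function.update_of_ne h _ _
  · intro s
    rw [opProgram_spec, combine, Function.update_of_ne (by omega), Function.update_self]
    cases s k <;> cases s (k + 1) <;> rfl

theorem implements_swap (k : ℕ) :
    Implements (fun s => s ∘ Equiv.swap k (k + 1)) 14 (2 * (k + 1)) := by
  refine implements_of_window swapProgram (by decide) ?_ ?_
  · intro s i h h'
    simp [Equiv.swap_apply_of_ne_of_ne h h']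
  · intro s
    rw [swapProgram_spec]
    simp

/-- Conjugation by the swap of the last two cells lowers the distance by one. Each unit of distance
costs two swaps of 14 steps. -/
theorem implements_combine (op : Bool → Bool → Bool) (i d : ℕ) :
    Implements (combine op i (i + d + 1)) (14 * (2 * d + 1)) (2 * (i + d + 1)) := by
  induction d with
  | zero => exact implements_combine_succ op i
  | succ d ih =>
    have h := (implements_swap (i + d + 1)).comp (ih.comp (implements_swap (i + d + 1)))
    have hF : (fun s : ℕ → Bool => combine op i (i + d + 1)
        (s ∘ Equiv.swap (i + d + 1) (i + d + 1 + 1)) ∘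
          Equiv.swap (i + d + 1) (i + d + 1 + 1)) = combine op i (i + (d + 1) + 1) := by
      funext s j
      simp only [combine, Function.comp_apply, Function.update_apply, ← add_assoc,
        Equiv.swap_apply_left]
      rw [Equiv.swap_apply_of_ne_of_ne (a := i + d + 1) (b := i + d + 1 + 1) (x := i)
        (by omega) (by omega)]
      by_cases hj : j = i + d + 1 + 1
      · simp [hj]
      · by_cases hj' : j = i + d + 1
        · simp [hj']
        · simp [Equiv.swap_apply_of_ne_of_ne hj' hj, hj, hj']
    rw [← hF]
    exact h.mono (by omega) (by omega)

/-! ### Compiling circuits into programs -/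

/-- The cells that hold the values `v` after a cell with the value `false`. -/
def cells {w : ℕ} (v : Fin w → Bool) : ℕ → Bool
  | 0 => false
  | k + 1 => if h : k < w then v ⟨k, h⟩ else false

theorem cells_succ {w : ℕ} (v : Fin w → Bool) (i : Fin w) : cells v (i + 1) = v i := by
  simp [cells]

theorem cells_snoc {w : ℕ} (v : Fin w → Bool) (b : Bool) :
    cells (Fin.snoc (α := fun _ => Bool) v b) = Function.update (cells v) (w + 1) b := by
  funext k
  rw [Function.update_apply]
  cases k with
  | zero => simp [cells]
  | succ k =>
    simp only [cells, Nat.add_right_cancel_iff]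
    rcases lt_trichotomy k w with h | rfl | h
    · rw [dif_pos (by omega), if_neg (by omega), dif_pos h]
      exact Fin.snoc_castSucc (α := fun _ => Bool) b v ⟨k, h⟩
    · rw [dif_pos (by omega), if_pos rfl]
      exact Fin.snoc_last (α := fun _ => Bool) b v
    · rw [dif_neg (by omega), if_neg (by omega), dif_neg (by omega)]

theorem implements_combine_le (op : Bool → Bool → Bool) {i p : ℕ} (h : i < p) :
    Implements (combine op i p) (28 * p) (2 * p) := by
  obtain ⟨d, rfl⟩ := Nat.exists_eq_add_of_lt h
  exact (implements_combine op i d).mono (by omega) le_rfl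

theorem implements_gate {w : ℕ} (g : BoolGate w) :
    ∃ F, Implements F (56 * (w + 1)) (2 * (w + 1)) ∧
      ∀ v : Fin w → Bool, F (cells v) = cells (Fin.snoc (α := fun _ => Bool) v (g.eval v)) := by
  cases g with
  | const b =>
    -- The spare cell 0 provides a left partner for the target even when there are no wires yet.
    refine ⟨_, (implements_combine_le (fun _ _ => b) (Nat.succ_pos w)).mono (by omega) le_rfl,
      fun v => ?_⟩
    rw [cells_snoc]
    rfl
  | binary op i j =>
    -- First copy wire `j` into the new cell, then combine it with wire `i`. The sources survive,
    -- which gives unrestricted fan-out and allows `i = j`.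
    refine ⟨_, ((implements_combine_le op (i := i + 1) (p := w + 1) (by omega)).comp
      (implements_combine_le (fun a _ => a) (i := j + 1) (p := w + 1) (by omega))).mono
        (by omega) (by omega), fun v => ?_⟩
    have hi := i.2
    rw [cells_snoc]
    simp only [combine, Function.update_self, Function.update_idem]
    rw [Function.update_of_ne (by omega), cells_succ, cells_succ]
    rfl

theorem GateSeq.exists_program {n w : ℕ} (c : GateSeq n w) :
    ∃ P : List (ℕ × Brick), P.length ≤ c.length * (56 * w) ∧ (∀ q ∈ P, q.1 < 2 * w) ∧
      ∀ x : Fin n → Bool, runProgram P (interleave (cells x)) = interleave (cells (c.eval x)) := by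
  induction c with
  | nil => exact ⟨[], by simp, by simp, fun x => rfl⟩
  | snoc c g ih =>
    rename_i w
    obtain ⟨P, hPl, hPB, hP⟩ := ih
    obtain ⟨F, ⟨Q, hQl, hQB, hQ⟩, hF⟩ := implements_gate g
    refine ⟨P ++ Q, ?_, fun q hq => ?_, fun x => ?_⟩
    · rw [List.length_append, GateSeq.length, add_one_mul]
      exact add_le_add (hPl.trans (Nat.mul_le_mul_left _ (by omega))) hQl
    · rcases List.mem_append.1 hq with h | h
      · have := hPB q h
        omega
      · exact hQB q h
    · rw [runProgram_append, hP, hQ, hF]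
      rfl

theorem GateSeq.wires_eq {n w : ℕ} (c : GateSeq n w) : w = n + c.length := by
  induction c with
  | nil => rfl
  | snoc c g ih => rw [GateSeq.length]; omega

/-- Output sites must be distinct, yet several outputs may name the same wire; each output gets its
own copy. -/
theorem GateSeq.exists_copies {n w m : ℕ} (c : GateSeq n w) (out : Fin m → Fin w) :
    ∃ c' : GateSeq n (w + m), c'.length = c.length + m ∧ ∀ x,
      (∀ i, c'.eval x (Fin.castAdd m i) = c.eval x i) ∧
      ∀ j, c'.eval x (Fin.natAdd w j) = c.eval x (out j) := by
  induction m with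
  | zero => exact ⟨c, rfl, fun x => ⟨fun i => rfl, fun j => j.elim0⟩⟩
  | succ m ih =>
    obtain ⟨c', hl, hc'⟩ := ih fun j => out j.castSucc
    refine ⟨c'.snoc (.binary (fun a _ => a) (Fin.castAdd m (out (Fin.last m)))
      (Fin.castAdd m (out (Fin.last m)))), by rw [GateSeq.length, hl]; rfl, fun x => ⟨fun i => ?_,
        fun j => ?_⟩⟩
    · rw [← (hc' x).1 i]
      exact Fin.snoc_castSucc (α := fun _ => Bool) _ _ (Fin.castAdd m i)
    · induction j using Fin.lastCases with
      | last =>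
        rw [← (hc' x).1]
        exact Fin.snoc_last (α := fun _ => Bool) _ _
      | cast j =>
        rw [← (hc' x).2 j]
        exact Fin.snoc_castSucc (α := fun _ => Bool) _ _ (Fin.natAdd w j)

/-! ### From programs to encoding Hamiltonians -/

theorem exists_cells_of_forall {n : ℕ} {r : ℕ → Bool}
    (hr : ∀ j, ¬ (j % 2 = 0 ∧ 0 < j ∧ j ≤ 2 * n) → r j = false) :
    r = interleave (cells fun i : Fin n => r (2 * (i + 1))) := by
  funext j
  rw [interleave]
  split_ifs with h
  · obtain ⟨k, rfl⟩ : ∃ k, j = 2 * k := ⟨j / 2, by omega⟩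
    rw [Nat.mul_div_cancel_left _ two_pos]
    cases k with
    | zero => exact hr _ (by omega)
    | succ k =>
      rw [cells]
      split_ifs with hk
      · rfl
      · exact hr _ (by omega)
  · exact hr _ (by omega)

theorem interleave_cells_eq_false {n : ℕ} (x : Fin n → Bool) (j : ℕ)
    (hj : ¬ (j % 2 = 0 ∧ 0 < j ∧ j ≤ 2 * n)) : interleave (cells x) j = false := by
  rw [interleave]
  split_ifs with h
  · obtain ⟨k, rfl⟩ : ∃ k, j = 2 * k := ⟨j / 2, by omega⟩
    rw [Nat.mul_div_cancel_left _ two_pos]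
    cases k with
    | zero => rfl
    | succ k => rw [cells, dif_neg (by omega)]
  · rfl

theorem interleave_cells_apply {w : ℕ} (v : Fin w → Bool) (i : Fin w) :
    interleave (cells v) (2 * (i + 1)) = v i := by
  rw [interleave, if_pos (by omega), Nat.mul_div_cancel_left _ two_pos, cells_succ]

/-- One parameter `K` bounds both directions of the square: `2 * K` layers hold `K` steps, and `w <
K` leaves column `2 * K` a pure wire. Inputs are read in the first row and outputs in the last. -/
theorem exists_encodes_of_program {n m w : ℕ} (f : (Fin n → Bool) → Fin m → Bool)
    (F : (Fin n → Bool) → Fin w → Bool) (out : Fin m ↪ Fin w)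
    (hF : ∀ x j, F x (out j) = f x j) (P : List (ℕ × Brick)) (K : ℕ) (hn : n ≤ w)
    (hw : w < K) (hP : P.length ≤ K) (hPB : ∀ q ∈ P, q.1 < 2 * w)
    (hrun : ∀ x, runProgram P (interleave (cells x)) = interleave (cells (F x))) :
    ∃ (H : IsingHamiltonian (Fin (2 * K + 1) × Fin (2 * K + 1)))
      (site : Fin n ⊕ Fin m ↪ Fin (2 * K + 1) × Fin (2 * K + 1)),
      H.IsSquare ∧ H.Encodes site f := by
  have hlast : ∀ x : Fin n → Bool, evolve (schedule P) (interleave (cells x)) (2 * K) =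
      interleave (cells (F x)) := fun x => by
    rw [evolve_schedule, List.take_of_length_le hP, hrun]
  have hwire : ∀ t, schedule P t (2 * K) = .wire := by
    intro t
    rw [schedule]
    split
    · rename_i q hq
      have := hPB q (List.mem_of_getElem? hq)
      exact if_neg (by omega)
    · rfl
  let site : Fin n ⊕ Fin m → Fin (2 * K + 1) × Fin (2 * K + 1) := Sum.elim
    (fun i => (⟨0, by omega⟩, ⟨2 * (i + 1), by omega⟩))
    (fun j => (⟨2 * K, by omega⟩, ⟨2 * (out j + 1), by omega⟩))
  have hsite : Function.Injective site := by
    rintro (i | i) (j | j) h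
    · simp only [site, Sum.elim_inl, Prod.mk.injEq, Fin.mk.injEq] at h
      exact congrArg Sum.inl (Fin.ext (by omega))
    · simp only [site, Sum.elim_inl, Sum.elim_inr, Prod.mk.injEq, Fin.mk.injEq] at h
      omega
    · simp only [site, Sum.elim_inl, Sum.elim_inr, Prod.mk.injEq, Fin.mk.injEq] at h
      omega
    · simp only [site, Sum.elim_inr, Prod.mk.injEq, Fin.mk.injEq] at h
      exact congrArg Sum.inr (out.injective (Fin.ext (by omega)))
  -- Admissible first rows are the interleaved inputs, and the program returns interleaved rows, so
  -- the odd columns end at zero.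
  have ground := brickwork_isGroundState_iff hwire (fun j => j % 2 = 0 ∧ 0 < j ∧ j ≤ 2 * n)
    (fun j h => h.1) (fun r hr j _ hj => by
      rw [exists_cells_of_forall hr, hlast]
      exact interleave_cells_eq_false _ _ (by omega))
  have ground' : ∀ b : Fin (2 * K + 1) × Fin (2 * K + 1) → Bool, (brickworkHamiltonian (schedule P)
      (2 * K) fun j => if j % 2 = 0 ∧ 0 < j ∧ j ≤ 2 * n then 0 else 1).IsGroundState b ↔
      ∃ x : Fin n → Bool, (∀ i, b (site (.inl i)) = x i) ∧
        ∀ u, b u = evolve (schedule P) (interleave (cells x)) u.1 u.2 := by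
    intro b
    rw [ground]
    constructor
    · rintro ⟨r, hr, hb⟩
      refine ⟨fun i => r (2 * (i + 1)), fun i => hb _, ?_⟩
      rwa [← exists_cells_of_forall hr]
    · rintro ⟨x, -, hb⟩
      exact ⟨_, interleave_cells_eq_false x, hb⟩
  refine ⟨_, ⟨site, hsite⟩, brickworkHamiltonian_isSquare (schedule P) (2 * K)
    (fun j => if j % 2 = 0 ∧ 0 < j ∧ j ≤ 2 * n then 0 else 1), fun x => ?_, fun b hb j => ?_⟩
  · refine ⟨fun u => evolve (schedule P) (interleave (cells x)) u.1 u.2, ?_, ?_⟩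
    · have hx : ∀ i, evolve (schedule P) (interleave (cells x)) (site (.inl i)).1
          (site (.inl i)).2 = x i := fun i => interleave_cells_apply x i
      exact ⟨(ground' _).2 ⟨x, hx, fun u => rfl⟩, hx⟩
    · rintro b ⟨hb, hbx⟩
      obtain ⟨x', hx', hb'⟩ := (ground' b).1 hb
      obtain rfl : x' = x := funext fun i => (hx' i).symm.trans (hbx i)
      exact funext hb'
  · obtain ⟨x, hx, hb'⟩ := (ground' b).1 hb
    have hx' : (fun i => b (site (.inl i))) = x := funext hx
    change b (site (.inr j)) = f (fun i => b (site (.inl i))) j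
    rw [hx', hb']
    change evolve (schedule P) (interleave (cells x)) (2 * K) (2 * (out j + 1)) = f x j
    rw [hlast, interleave_cells_apply, hF]

/-- With output copies there are at most `C.size` gates and exactly `C.size` wires, at a cost of at
most 56 steps per gate and wire. The `+ 1` keeps the width strictly larger than the number of wires
even at size 0. -/
theorem BoolCircuit.exists_encodes {n m : ℕ} (C : BoolCircuit n m) :
    ∃ (H : IsingHamiltonian (Fin (2 * (56 * (C.size + 1) ^ 2) + 1) ×
        Fin (2 * (56 * (C.size + 1) ^ 2) + 1)))
      (site : Fin n ⊕ Fin m ↪ Fin (2 * (56 * (C.size + 1) ^ 2) + 1) ×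
        Fin (2 * (56 * (C.size + 1) ^ 2) + 1)),
      H.IsSquare ∧ H.Encodes site C.eval := by
  obtain ⟨c, hl, hc⟩ := C.body.exists_copies C.out
  obtain ⟨P, hPl, hPB, hP⟩ := c.exists_program
  have hw := C.body.wires_eq
  have hs : C.wires + m = C.size := by rw [BoolCircuit.size]; omega
  refine exists_encodes_of_program C.eval c.eval (Fin.natAddEmb C.wires)
    (fun x j => (hc x).2 j) P _ (by omega) (by rw [hs]; nlinarith) (hPl.trans ?_) hPB hP
  have h1 : c.length ≤ C.size + 1 := by rw [hl]; omega
  calc c.length * (56 * (C.wires + m)) ≤ (C.size + 1) * (56 * (C.size + 1)) :=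
        Nat.mul_le_mul h1 (by omega)
    _ = 56 * (C.size + 1) ^ 2 := by ring

/-! ### Every Boolean function has a circuit -/

/-- Every sequence of gates can be continued to one that has `φ` on some wire. -/
def GateComputable {n : ℕ} (φ : (Fin n → Bool) → Bool) : Prop :=
  ∀ w (c : GateSeq n w), ∃ w' : ℕ, ∃ c' : GateSeq n w', ∃ e : Fin w → Fin w', ∃ k : Fin w',
    ∀ x, (∀ i, c'.eval x (e i) = c.eval x i) ∧ c'.eval x k = φ x

theorem gateComputable_const {n : ℕ} (b : Bool) :
    GateComputable fun _ : Fin n → Bool => b := fun w c =>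
  ⟨w + 1, c.snoc (.const b), Fin.castSucc, Fin.last w, fun _ =>
    ⟨fun i => Fin.snoc_castSucc (α := fun _ => Bool) _ _ i,
      Fin.snoc_last (α := fun _ => Bool) _ _⟩⟩

theorem GateSeq.exists_input {n w : ℕ} (c : GateSeq n w) (i : Fin n) :
    ∃ k, ∀ x, c.eval x k = x i := by
  induction c with
  | nil => exact ⟨i, fun x => rfl⟩
  | snoc c g ih =>
    obtain ⟨k, hk⟩ := ih
    exact ⟨k.castSucc, fun x => (Fin.snoc_castSucc (α := fun _ => Bool) _ _ k).trans (hk x)⟩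

theorem gateComputable_apply {n : ℕ} (i : Fin n) :
    GateComputable fun x : Fin n → Bool => x i := fun w c => by
  obtain ⟨k, hk⟩ := c.exists_input i
  exact ⟨w, c, id, k, fun x => ⟨fun _ => rfl, hk x⟩⟩

theorem GateComputable.binary {n : ℕ} {φ ψ : (Fin n → Bool) → Bool} (hφ : GateComputable φ)
    (hψ : GateComputable ψ) (op : Bool → Bool → Bool) :
    GateComputable fun x => op (φ x) (ψ x) := fun w c => by
  -- Continuing the sequence for `φ` by one for `ψ` keeps the value of `φ` on the wire `e₂ k₁`.
  obtain ⟨w₁, c₁, e₁, k₁, h₁⟩ := hφ w c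
  obtain ⟨w₂, c₂, e₂, k₂, h₂⟩ := hψ w₁ c₁
  refine ⟨w₂ + 1, c₂.snoc (.binary op (e₂ k₁) k₂), fun i => (e₂ (e₁ i)).castSucc, Fin.last w₂,
    fun x => ⟨fun i => ?_, ?_⟩⟩
  · rw [← (h₁ x).1, ← (h₂ x).1]
    exact Fin.snoc_castSucc (α := fun _ => Bool) _ _ _
  · have : op (φ x) (ψ x) = op (c₂.eval x (e₂ k₁)) (c₂.eval x k₂) := by
      rw [(h₂ x).1, (h₁ x).2, (h₂ x).2]
    refine Eq.trans ?_ this.symm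
    exact Fin.snoc_last (α := fun _ => Bool) _ _

theorem gateComputable_eq {n : ℕ} (a : Fin n → Bool) :
    GateComputable fun x => decide (x = a) := by
  have h : ∀ s : Finset (Fin n), GateComputable fun x => decide (∀ i ∈ s, x i = a i) := by
    intro s
    induction s using Finset.induction_on with
    | empty => simpa using gateComputable_const true
    | insert i s _ ih =>
      have h' := (gateComputable_apply i).binary ih fun p q => decide (p = a i) && q
      refine (congrArg GateComputable (funext fun x => ?_)).mp h'
      simp [Bool.decide_and]
  simpa [funext_iff] using h Finset.univ

/-- Disjunctive normal form: `φ` is the disjunction of the point indicators over its true set. -/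
theorem gateComputable {n : ℕ} (φ : (Fin n → Bool) → Bool) : GateComputable φ := by
  have h : ∀ s : Finset (Fin n → Bool), GateComputable fun x => decide (x ∈ s) := by
    intro s
    induction s using Finset.induction_on with
    | empty => simpa using gateComputable_const false
    | insert a s _ ih =>
      have h' := (gateComputable_eq a).binary ih or
      refine (congrArg GateComputable (funext fun x => ?_)).mp h'
      simp [Bool.decide_or]
  simpa using h (Finset.univ.filter fun x => φ x = true)

theorem BoolCircuit.exists_eval_eq {n m : ℕ} (f : (Fin n → Bool) → Fin m → Bool) :
    ∃ C : BoolCircuit n m, C.eval = f := by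
  induction m with
  | zero => exact ⟨⟨n, .nil, Fin.elim0⟩, funext fun x => funext fun j => j.elim0⟩
  | succ m ih =>
    obtain ⟨C, hC⟩ := ih fun x j => f x j.castSucc
    obtain ⟨w, c, e, k, h⟩ := gateComputable (fun x => f x (Fin.last m)) C.wires C.body
    refine ⟨⟨w, c, Fin.snoc (α := fun _ => Fin w) (fun j => e (C.out j)) k⟩,
      funext fun x => funext fun j => ?_⟩
    change c.eval x (Fin.snoc (α := fun _ => Fin w) (fun j => e (C.out j)) k j) = f x j
    induction j using Fin.lastCases with
    | last => rw [Fin.snoc_last, (h x).2]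
    | cast j => rw [Fin.snoc_castSucc, (h x).1]; exact congrFun (congrFun hC x) j

theorem theorem2 :
    (∀ (n m : ℕ) (f : (Fin n → Bool) → (Fin m → Bool)),
      ∃ (N : ℕ) (H : IsingHamiltonian (Fin N × Fin N)) (site : Fin n ⊕ Fin m ↪ Fin N × Fin N),
        H.IsSquare ∧ H.Encodes site f) ∧
    (∃ P : Polynomial ℕ, ∀ (n m : ℕ) (f : (Fin n → Bool) → (Fin m → Bool))
      (C : BoolCircuit n m), C.eval = f →
      ∃ (N : ℕ) (H : IsingHamiltonian (Fin N × Fin N)) (site : Fin n ⊕ Fin m ↪ Fin N × Fin N),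
        H.IsSquare ∧ H.Encodes site f ∧ Fintype.card (Fin N × Fin N) ≤ P.eval C.size) := by
  constructor
  · intro n m f
    obtain ⟨C, rfl⟩ := BoolCircuit.exists_eval_eq f
    exact ⟨_, C.exists_encodes⟩
  · refine ⟨(2 * (56 * (Polynomial.X + 1) ^ 2) + 1) ^ 2, ?_⟩
    rintro n m _ C rfl
    obtain ⟨H, site, hH, hf⟩ := C.exists_encodes
    refine ⟨_, H, site, hH, hf, ?_⟩
    simp [sq]
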